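/- Let $R$ be a commutative ring with identity. An ideal $I$ of $R$ is dense if $(0:_R I)=0$, and semi-regular if it contains a finitely generated dense ideal; let $\mathcal{Q}$ be the set of finitely generated semi-regular ideals of $R$. Let $T(R[x])$ be the total quotient ring of $R[x]$ and $Q_0(R)=\{\alpha\in T(R[x]) : I\alpha\subseteq R \text{ for some } I\in\mathcal{Q}\}$. For an ideal $N$ of $R$ put $N_q=\{\alpha\in T(R[x]) : I\alpha\subseteq N\text{ for some } I\in\mathcal{Q}\}$; $N$ is a $q$-ideal if $N_q\cap R=N$, and $q\text{-}\mathrm{Max}(R)$ is the set of maximal elements among the proper $q$-ideals (these are prime ideals). An $R$-module $M$ is $\mathcal{Q}$-torsion if every $x\in M$ satisfies $Ix=0$ for some $I\in\mathcal{Q}$. A homomorphism of $R$-modules is a $\tau_q$-monomorphism (resp. $\tau_q$-epimorphism), and a sequence of $R$-modules is $\tau_q$-exact, if it becomes injective (resp. surjective), respectively exact, after localizing at every $\mathfrak{m}\in q\text{-}\mathrm{Max}(R)$. A module $M$ is $\tau_q$-finitely generated if there is a $\tau_q$-epimorphism $F\to M$ with $F$ finitely generated free, and $\tau_q$-flat if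 $1_M\otimes f$ is a $\tau_q$-monomorphism for every $\tau_q$-monomorphism $f$. The $\tau_q$-flat dimension $\tau_q\text{-}\mathrm{fd}_R(M)$ is the least $n$ for which there is a $\tau_q$-exact sequence $0\to F_n\to\cdots\to F_0\to M\to 0$ with all $F_i$ $\tau_q$-flat ($\infty$ if there is none), and $\tau_q\text{-}\mathrm{w.gl.dim}(R)=\sup\{\tau_q\text{-}\mathrm{fd}_R(M) : M \text{ an } R\text{-module}\}$. The ring $R$ is $\tau_q$-von Neumann regular if every $R$-module is $\tau_q$-flat. A commutative ring $A$ is von Neumann regular if for every $a\in A$ there is $b\in A$ with $a=aba$. The set $\mathrm{Min}(R)$ of minimal prime ideals carries the topology induced from $\mathrm{Spec}(R)$. The following assertions are equivalent: 1. $\tau_q\text{-}\mathrm{w.gl.dim}(R)=0$; 2. $R$ is $\tau_q$-von Neumann regular; 3. $\mathrm{Tor}^R_k(M,N)$ is $\mathcal{Q}$-torsion for all $R$-modules $M,N$ and all $k>0$; 4. $\mathrm{Tor}^R_1(M,N)$ is $\mathcal{Q}$-torsion for all $R$-modules $M,N$; 5. (a) $R/I$ is $\tau_q$-flat for all ideals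 $I$ of $R$; (b) the same for all $\tau_q$-finitely generated ideals $I$; (c) the same for all finitely generated ideals $I$ (each of (a), (b), (c) separately being equivalent to the other assertions); 6. for every finitely generated ideal $K$ of $R$ there exists $I\in\mathcal{Q}$ such that $IK=K^2$; 7. $R_{\mathfrak{m}}$ is von Neumann regular for every $\mathfrak{m}\in q\text{-}\mathrm{Max}(R)$; 8. $T(R[x])$ is von Neumann regular; 9. $R$ is reduced and $\mathrm{Min}(R)$ is compact; 10. $Q_0(R)$ is von Neumann regular. -/

import Mathlib

open Polynomial TensorProduct

universe u

namespace QOp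

section Ideals

variable {R : Type u} [CommRing R]

/-- An ideal `I` is dense if `(0 :_R I) = 0`. -/
def IsDense (I : Ideal R) : Prop :=
  ∀ r : R, (∀ a ∈ I, a * r = 0) → r = 0

/-- An ideal is semi-regular if it contains a finitely generated dense ideal. -/
def IsSemiregular (I : Ideal R) : Prop :=
  ∃ J : Ideal R, J ≤ I ∧ J.FG ∧ IsDense J

variable (R) in
/-- The set `𝒬(R)` of finitely generated semi-regular ideals of `R`. -/
def fgSemiregular : Set (Ideal R) :=
  {I | I.FG ∧ IsSemiregular I}

/-- The Lucas envelope `N_q` of an ideal `N`, as the set of those `x` in the total quotient ring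
`T(R[X])` such that `I x ⊆ N` for some `I ∈ 𝒬(R)`. -/
def lucasEnvelope (N : Ideal R) : Set (FractionRing R[X]) :=
  {x | ∃ I ∈ fgSemiregular R, ∀ a ∈ I, ∃ r ∈ N, a • x = algebraMap R (FractionRing R[X]) r}

/-- `N` is a `q`-ideal of `R` if `N_q ∩ R = N`. -/
def IsQIdeal (N : Ideal R) : Prop :=
  {r : R | algebraMap R (FractionRing R[X]) r ∈ lucasEnvelope N} = (N : Set R)

variable (R) in
/-- The set `q-Max(R)` of maximal `q`-ideals: the maximal elements among the proper
`q`-ideals. -/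
def qMax : Set (Ideal R) :=
  {m | Maximal (fun I : Ideal R => I ≠ ⊤ ∧ IsQIdeal I) m}

theorem algebraMap_injective :
    Function.Injective (algebraMap R (FractionRing R[X])) := by
  rw [IsScalarTower.algebraMap_eq R R[X] (FractionRing R[X])]
  exact (IsFractionRing.injective R[X] (FractionRing R[X])).comp Polynomial.C_injective

theorem top_mem_fgSemiregular : (⊤ : Ideal R) ∈ fgSemiregular R :=
  ⟨⟨{1}, by simp⟩, ⊤, le_rfl, ⟨{1}, by simp⟩, fun r h => by simpa using h 1 trivial⟩

theorem mul_mem_fgSemiregular {I J : Ideal R} (hI : I ∈ fgSemiregular R)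
    (hJ : J ∈ fgSemiregular R) : I * J ∈ fgSemiregular R := by
  obtain ⟨hI, I', hI'I, hI'f, hI'd⟩ := hI
  obtain ⟨hJ, J', hJ'J, hJ'f, hJ'd⟩ := hJ
  refine ⟨hI.mul hJ, I' * J', Ideal.mul_mono hI'I hJ'J, hI'f.mul hJ'f, fun r hr => ?_⟩
  refine hJ'd r fun b hb => hI'd _ fun a ha => ?_
  rw [← mul_assoc]
  exact hr _ (Ideal.mul_mem_mul ha hb)

theorem mem_lucasEnvelope_algebraMap {N : Ideal R} {r : R} :
    algebraMap R (FractionRing R[X]) r ∈ lucasEnvelope N ↔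
      ∃ I ∈ fgSemiregular R, ∀ a ∈ I, a * r ∈ N := by
  constructor
  · rintro ⟨I, hI, h⟩
    refine ⟨I, hI, fun a ha => ?_⟩
    obtain ⟨s, hs, e⟩ := h a ha
    rw [Algebra.smul_def, ← map_mul] at e
    rwa [algebraMap_injective e]
  · rintro ⟨I, hI, h⟩
    exact ⟨I, hI, fun a ha => ⟨a * r, h a ha, by rw [Algebra.smul_def, ← map_mul]⟩⟩

theorem isQIdeal_iff {N : Ideal R} :
    IsQIdeal N ↔ ∀ r : R, ∀ I ∈ fgSemiregular R, (∀ a ∈ I, a * r ∈ N) → r ∈ N := by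
  constructor
  · intro h r I hI hr
    exact h.le (mem_lucasEnvelope_algebraMap.2 ⟨I, hI, hr⟩)
  · intro h
    ext r
    rw [Set.mem_ofPred_eq, mem_lucasEnvelope_algebraMap]
    exact ⟨fun ⟨I, hI, hr⟩ => h r I hI hr,
      fun hr => ⟨⊤, top_mem_fgSemiregular, fun a _ => N.mul_mem_left a hr⟩⟩

/-- Maximal `q`-ideals are prime. -/
instance isPrime_qMax (m : qMax R) : (m : Ideal R).IsPrime := by
  obtain ⟨m, hm'⟩ := m
  have hm : Maximal (fun I : Ideal R => I ≠ ⊤ ∧ IsQIdeal I) m := hm'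
  refine ⟨hm.prop.1, fun {a b} hab => or_iff_not_imp_right.2 fun hb => ?_⟩
  have hq := isQIdeal_iff.1 hm.prop.2
  let c : Ideal R :=
    { carrier := {x | x * b ∈ m}
      add_mem' := fun {x y} hx hy => by
        simp only [Set.mem_ofPred_eq, add_mul] at *; exact m.add_mem hx hy
      zero_mem' := by simp
      smul_mem' := fun r x hx => by
        simp only [Set.mem_ofPred_eq, smul_eq_mul, mul_assoc] at *; exact m.mul_mem_left r hx }
  have hc : c ≠ ⊤ ∧ IsQIdeal c := by
    refine ⟨fun h => hb ?_, isQIdeal_iff.2 fun r I hI hr => ?_⟩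
    · have h1 : (1 : R) ∈ c := h ▸ trivial
      have h2 : (1 : R) * b ∈ m := h1
      simpa using h2
    · refine hq (r * b) I hI fun a ha => ?_
      rw [← mul_assoc]
      exact hr a ha
  exact hm.le_of_ge hc (fun x hx => m.mul_mem_right b hx) (show a ∈ c from hab)

variable (R) in
/-- Lucas' ring of finite fractions `Q₀(R)`: the `α ∈ T(R[X])` such that `I α ⊆ R` for some
`I ∈ 𝒬(R)`. -/
def finiteFractions : Subalgebra R (FractionRing R[X]) where
  carrier := {α | ∃ I ∈ fgSemiregular R, ∀ a ∈ I, ∃ r : R, a • α = 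
    algebraMap R (FractionRing R[X]) r}
  algebraMap_mem' r :=
    ⟨⊤, top_mem_fgSemiregular, fun a _ => ⟨a * r, by rw [Algebra.smul_def, ← map_mul]⟩⟩
  mul_mem' := by
    rintro x y ⟨I, hI, hx⟩ ⟨J, hJ, hy⟩
    refine ⟨I * J, mul_mem_fgSemiregular hI hJ, fun a ha => ?_⟩
    induction ha using Submodule.mul_induction_on' with
    | mem_mul_mem i hi j hj =>
      obtain ⟨r, hr⟩ := hx i hi
      obtain ⟨s, hs⟩ := hy j hj
      exact ⟨r * s, by rw [map_mul, ← hr, ← hs, smul_mul_smul_comm]⟩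
    | add p _ q _ hp hq =>
      obtain ⟨r, hr⟩ := hp
      obtain ⟨s, hs⟩ := hq
      exact ⟨r + s, by rw [add_smul, hr, hs, map_add]⟩
  add_mem' := by
    rintro x y ⟨I, hI, hx⟩ ⟨J, hJ, hy⟩
    refine ⟨I * J, mul_mem_fgSemiregular hI hJ, fun a ha => ?_⟩
    obtain ⟨r, hr⟩ := hx a ((Ideal.mul_le_left : I * J ≤ I) ha)
    obtain ⟨s, hs⟩ := hy a ((Ideal.mul_le_right : I * J ≤ J) ha)
    exact ⟨r + s, by rw [smul_add, hr, hs, map_add]⟩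

end Ideals

section Modules

variable (R : Type u) [CommRing R]

/-- `M` is `𝒬`-torsion: every element is annihilated by some `I ∈ 𝒬(R)`. -/
def IsQTorsion (M : Type u) [AddCommGroup M] [Module R M] : Prop :=
  ∀ x : M, ∃ I ∈ fgSemiregular R, ∀ a ∈ I, a • x = 0

variable {R}
variable {A B C : Type u} [AddCommGroup A] [Module R A] [AddCommGroup B] [Module R B]
  [AddCommGroup C] [Module R C]

/-- `f` is a `τ_q`-monomorphism: `f_𝔪` is injective for all `𝔪 ∈ q-Max(R)`. -/
def IsTauQMono (f : A →ₗ[R] B) : Prop :=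
  ∀ m : qMax R, Function.Injective (LocalizedModule.map (m : Ideal R).primeCompl f)

/-- `f` is a `τ_q`-epimorphism: `f_𝔪` is surjective for all `𝔪 ∈ q-Max(R)`. -/
def IsTauQEpi (f : A →ₗ[R] B) : Prop :=
  ∀ m : qMax R, Function.Surjective (LocalizedModule.map (m : Ideal R).primeCompl f)

/-- `A → B → C` is `τ_q`-exact: it is exact after localizing at any `𝔪 ∈ q-Max(R)`. -/
def IsTauQExact (f : A →ₗ[R] B) (g : B →ₗ[R] C) : Prop :=
  ∀ m : qMax R, Function.Exact (LocalizedModule.map (m : Ideal R).primeCompl f)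
    (LocalizedModule.map (m : Ideal R).primeCompl g)

variable (R)

/-- `M` is `τ_q`-finitely generated: there is a `τ_q`-exact sequence `F → M → 0` with `F` free
of finite rank. -/
def IsTauQFG (M : Type u) [AddCommGroup M] [Module R M] : Prop :=
  ∃ (k : ℕ) (f : (Fin k → R) →ₗ[R] M), IsTauQEpi f

/-- `M` is `τ_q`-flat: `M ⊗ -` preserves `τ_q`-monomorphisms. -/
def IsTauQFlat (M : Type u) [AddCommGroup M] [Module R M] : Prop :=
  ∀ (A B : Type u) [AddCommGroup A] [Module R A] [AddCommGroup B] [Module R B]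
    (f : A →ₗ[R] B), IsTauQMono f → IsTauQMono (f.lTensor M)

/-- There is a `τ_q`-exact sequence `0 → F n → ⋯ → F 1 → F 0 → M → 0` with all `F i` `τ_q`-flat;
the sequence is continued by zero modules in degrees `> n`. -/
def HasTauQFlatResolution (M : Type u) [AddCommGroup M] [Module R M] (n : ℕ) : Prop :=
  ∃ (F : ℕ → ModuleCat.{u} R) (d : ∀ i, F (i + 1) →ₗ[R] F i) (ε : F 0 →ₗ[R] M),
    (∀ i, IsTauQFlat R (F i)) ∧ (∀ i, n < i → Subsingleton (F i)) ∧
    IsTauQEpi ε ∧ IsTauQExact (d 0) ε ∧ ∀ i, IsTauQExact (d (i + 1)) (d i)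

/-- The `τ_q`-flat dimension of `M`: the least length of a `τ_q`-flat `τ_q`-resolution, and `∞`
if there is none of finite length. -/
noncomputable def tauQFlatDim (M : Type u) [AddCommGroup M] [Module R M] : ℕ∞ :=
  sInf {e : ℕ∞ | ∃ n : ℕ, e = n ∧ HasTauQFlatResolution R M n}

/-- The `τ_q`-weak global dimension of `R`. -/
noncomputable def tauQWeakGlobalDim : ℕ∞ :=
  ⨆ M : ModuleCat.{u} R, tauQFlatDim R M

/-- `R` is `τ_q`-von Neumann regular: all `R`-modules are `τ_q`-flat. -/
def IsTauQVNRegular : Prop :=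
  ∀ (M : Type u) [AddCommGroup M] [Module R M], IsTauQFlat R M

/-- `R` is von Neumann regular. -/
def IsVNRegular : Prop :=
  ∀ a : R, ∃ b : R, a = a * b * a

/-- The `R`-module `Tor_k^R(M, N)`. -/
noncomputable abbrev TorModule (k : ℕ) (M N : ModuleCat.{u} R) : ModuleCat.{u} R :=
  ((CategoryTheory.Tor (ModuleCat.{u} R) k).obj M).obj N

end Modules

end QOp

namespace QOp

/-! ### Semi-regular ideals and maximal `q`-ideals -/

section Ideals

variable {R : Type u} [CommRing R]

/-! The bridge between local and global is `exists_mem_fgSemiregular_le`: an ideal contained in no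
maximal `q`-ideal contains a member of `𝒬(R)`, while no maximal `q`-ideal contains one. Hence an
element vanishes at every `𝔪 ∈ q-Max(R)` iff some `I ∈ 𝒬(R)` kills it.

A von Neumann regular `R_𝔪` is a field, so injections over it split. This makes all modules
`τ_q`-flat, and then all higher Tor modules `𝒬`-torsion. Conversely `K/K²` is both `Tor₁(R/K, R/K)`
and the kernel of `(R/K) ⊗ K → (R/K) ⊗ R`. For `K` finitely generated, its being torsion gives `IK =
K²`; the case `K = (a)` says that `a ∈ a²R_𝔪`, which is regularity of `R_𝔪`.

The remaining conditions pass through `HasDenseComplements`. If all `R_𝔪` are fields, `K + Ann K`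
lies in no `𝔪`, which provides a complement. Complements yield quasi-inverses in `T(R[X])` and
`Q₀(R)`, reducedness, and compactness of `Min(R)`; the last two together return complements.
Regularity of `T(R[X])` or `Q₀(R)` descends to `IsLocallyRegular` by clearing denominators, and
thence to every `R_𝔪`. -/

theorem IsDense.mono {I J : Ideal R} (hI : IsDense I) (h : I ≤ J) : IsDense J :=
  fun r hr => hI r fun a ha => hr a (h ha)

theorem mem_fgSemiregular_iff {I : Ideal R} : I ∈ fgSemiregular R ↔ I.FG ∧ IsDense I :=
  ⟨fun ⟨h, _, hJ, _, hd⟩ => ⟨h, hd.mono hJ⟩, fun ⟨h, hd⟩ => ⟨h, I, le_rfl, h, hd⟩⟩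

theorem mem_fgSemiregular_of_le {I J : Ideal R} (hI : I ∈ fgSemiregular R) (hJ : J.FG)
    (h : I ≤ J) : J ∈ fgSemiregular R :=
  mem_fgSemiregular_iff.2 ⟨hJ, (mem_fgSemiregular_iff.1 hI).2.mono h⟩

theorem eq_top_of_isQIdeal {I J : Ideal R} (hI : IsQIdeal I) (hJ : J ∈ fgSemiregular R)
    (h : J ≤ I) : I = ⊤ :=
  (Ideal.eq_top_iff_one I).2 (isQIdeal_iff.1 hI 1 J hJ fun a ha => by simpa using h ha)

theorem not_le_qMax {J : Ideal R} (hJ : J ∈ fgSemiregular R) (m : qMax R) : ¬ J ≤ m :=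
  fun h =>
    have hm : Maximal (fun I : Ideal R => I ≠ ⊤ ∧ IsQIdeal I) m := m.2
    hm.prop.1 (eq_top_of_isQIdeal hm.prop.2 hJ h)

/-- An ideal that contains no member of `𝒬(R)` is contained in a maximal `q`-ideal. -/
theorem exists_le_qMax {A : Ideal R} (hA : ∀ J ∈ fgSemiregular R, ¬ J ≤ A) :
    ∃ m : qMax R, A ≤ m := by
  obtain ⟨P, hAP, hP⟩ := zorn_le_nonempty₀ {I : Ideal R | ∀ J ∈ fgSemiregular R, ¬ J ≤ I}
    -- Members of `𝒬(R)` are compact, so one below the supremum of a chain lies below an element of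
    -- the chain.
    (fun c hc hcc y hy => by
      refine ⟨sSup c, fun J hJ hle => ?_, fun z hz => le_sSup hz⟩
      obtain ⟨I, hI, hJI⟩ :=
        (CompleteLattice.isCompactElement_iff_le_of_directed_sSup_le (Ideal R) J).1
          ((Submodule.fg_iff_compact J).1 hJ.1) c ⟨y, hy⟩ hcc.directedOn hle
      exact hc hI J hJ hJI) A hA
  refine ⟨⟨P, ⟨?_, isQIdeal_iff.2 fun r I hI hr => ?_⟩, fun N hN hPN => ?_⟩, hAP⟩
  · rintro rfl
    exact hP.prop ⊤ top_mem_fgSemiregular le_rfl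
  -- If `P ⊔ (r)` contained `J ∈ 𝒬(R)`, then `P` would contain `I * J ∈ 𝒬(R)`; maximality therefore
  -- puts `r` in `P`.
  · refine hP.le_of_ge (y := P ⊔ Ideal.span {r}) (fun J hJ hle => ?_) le_sup_left
      (Ideal.mem_sup_right (Ideal.mem_span_singleton_self r))
    refine hP.prop (I * J) (mul_mem_fgSemiregular hI hJ)
      ((Ideal.mul_mono_right hle).trans ?_)
    rw [Ideal.mul_sup]
    refine sup_le Ideal.mul_le_right (Ideal.mul_le.2 fun a ha b hb => ?_)
    obtain ⟨s, rfl⟩ := Ideal.mem_span_singleton'.1 hb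
    rw [mul_left_comm]
    exact P.mul_mem_left s (hr a ha)
  · exact hP.le_of_ge (fun J hJ hle => hN.1 (eq_top_of_isQIdeal hN.2 hJ hle)) hPN

theorem exists_mem_fgSemiregular_le {A : Ideal R} (hA : ∀ m : qMax R, ¬ A ≤ m) :
    ∃ J ∈ fgSemiregular R, J ≤ A := by
  by_contra! h
  obtain ⟨m, hm⟩ := exists_le_qMax h
  exact hA m hm

/-- A polynomial is regular iff its coefficients generate a dense ideal. -/
theorem mem_nonZeroDivisors_iff_isDense {f : R[X]} :
    f ∈ nonZeroDivisors R[X] ↔ Ideal.span (f.coeffs : Set R) ∈ fgSemiregular R := by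
  rw [Polynomial.mem_nonZeroDivisors_iff, mem_fgSemiregular_iff]
  refine ⟨fun h => ⟨⟨_, rfl⟩, fun r hr => h r ?_⟩, fun h r hr => h.2 r fun a ha => ?_⟩
  · ext n
    by_cases hn : f.coeff n = 0
    · simp [hn]
    · rw [coeff_smul, smul_eq_mul, mul_comm, coeff_zero]
      exact hr _ (Ideal.subset_span (coeff_mem_coeffs hn))
  · induction ha using Submodule.span_induction with
    | mem x hx =>
      obtain ⟨n, -, rfl⟩ := mem_coeffs_iff.1 hx
      simpa [mul_comm] using congrArg (fun p : R[X] => p.coeff n) hr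
    | zero => simp
    | add x y _ _ hx hy => rw [add_mul, hx, hy, add_zero]
    | smul c x _ hx => rw [smul_eq_mul, mul_assoc, hx, mul_zero]

/-! ### Dense complements and von Neumann regular rings of fractions -/

variable (R) in
/-- Every finitely generated ideal has a finitely generated complement up to `𝒬(R)`. -/
def HasDenseComplements : Prop :=
  ∀ K : Ideal R, K.FG → ∃ L : Ideal R, L.FG ∧ K * L = ⊥ ∧ K ⊔ L ∈ fgSemiregular R

variable (R) in
/-- Principal ideals are idempotent up to `𝒬(R)`. -/
def IsLocallyRegular : Prop :=
  ∀ a : R, ∃ J ∈ fgSemiregular R, ∀ j ∈ J, ∃ r : R, j * a = a * r * a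

theorem exists_fg_le_of_le_sup {J K A : Ideal R} (hJ : J.FG) (h : J ≤ K ⊔ A) :
    ∃ L : Ideal R, L.FG ∧ L ≤ A ∧ J ≤ K ⊔ L := by
  classical
  obtain ⟨t, rfl⟩ := hJ
  have h' : ∀ x ∈ t, ∃ a ∈ A, ∃ k ∈ K, k + a = x := fun x hx => by
    obtain ⟨k, hk, a, ha, e⟩ := Submodule.mem_sup.1 (h (Ideal.subset_span hx))
    exact ⟨a, ha, k, hk, e⟩
  choose! a ha k hk e using h'
  refine ⟨Ideal.span (t.image a : Finset R), ⟨_, rfl⟩, Ideal.span_le.2 fun y hy => ?_,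
    Ideal.span_le.2 fun x hx => ?_⟩
  · obtain ⟨x, hx, rfl⟩ := Finset.mem_image.1 (Finset.mem_coe.1 hy)
    exact ha x hx
  · exact Submodule.mem_sup.2 ⟨k x, hk x hx, a x,
      Ideal.subset_span (Finset.mem_coe.2 (Finset.mem_image_of_mem a hx)), e x hx⟩

/-- `K.annihilator` need not be finitely generated, but the finitely many generators of `J` use only
a finitely generated part of it. -/
theorem exists_complement {J K : Ideal R} (hK : K.FG) (hJ : J ∈ fgSemiregular R)
    (h : J ≤ K ⊔ K.annihilator) :
    ∃ L : Ideal R, L.FG ∧ K * L = ⊥ ∧ K ⊔ L ∈ fgSemiregular R := by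
  obtain ⟨L, hL, hLK, hKL⟩ := exists_fg_le_of_le_sup hJ.1 h
  refine ⟨L, hL, ?_, mem_fgSemiregular_of_le hJ (Submodule.FG.sup hK hL) hKL⟩
  rw [eq_bot_iff, mul_comm, ← Submodule.annihilator_mul K]
  exact Ideal.mul_mono_left hLK

theorem HasDenseComplements.exists_mul_eq_sq (h : HasDenseComplements R) (K : Ideal R)
    (hK : K.FG) : ∃ I ∈ fgSemiregular R, I * K = K ^ 2 := by
  obtain ⟨L, -, hKL, hL⟩ := h K hK
  exact ⟨_, hL, by rw [Ideal.sup_mul, mul_comm L, hKL, sup_bot_eq, sq]⟩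

theorem isLocallyRegular_of_mul_eq_sq
    (h : ∀ K : Ideal R, K.FG → ∃ I ∈ fgSemiregular R, I * K = K ^ 2) : IsLocallyRegular R := by
  intro a
  obtain ⟨I, hI, e⟩ := h (Ideal.span {a}) ⟨{a}, by simp⟩
  refine ⟨I, hI, fun j hj => ?_⟩
  have h1 : j * a ∈ Ideal.span {a} ^ 2 :=
    e ▸ Ideal.mul_mem_mul hj (Ideal.mem_span_singleton_self a)
  rw [Ideal.span_singleton_pow, Ideal.mem_span_singleton'] at h1
  obtain ⟨r, hr⟩ := h1
  exact ⟨r, by rw [← hr]; ring⟩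

theorem IsLocallyRegular.isVNRegular_localization (h : IsLocallyRegular R) (m : qMax R) :
    IsVNRegular (Localization (m : Ideal R).primeCompl) := by
  intro x
  obtain ⟨a, s, rfl⟩ := IsLocalization.exists_mk'_eq (m : Ideal R).primeCompl x
  obtain ⟨J, hJ, hr⟩ := h a
  -- Such a `j` is a unit in `R_𝔪`, so `j * a = a * r * a` makes `r * s / j` a quasi-inverse of `a /
  -- s`.
  obtain ⟨j, hj, hjm⟩ := Set.not_subset.1 (not_le_qMax hJ m)
  obtain ⟨r, hr⟩ := hr j hj
  refine ⟨IsLocalization.mk' _ (r * s) (⟨j, hjm⟩ : (m : Ideal R).primeCompl), ?_⟩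
  rw [← IsLocalization.mk'_mul, ← IsLocalization.mk'_mul, IsLocalization.mk'_eq_iff_eq]
  congr 1
  simp only [Submonoid.coe_mul]
  linear_combination (s : R) ^ 2 * hr

/-- With quasi-inverse `p / q` of `a`, the identity `q * a = a * p * a` is compared coefficientwise;
the coefficients of the regular `q` generate a member of `𝒬(R)`. -/
theorem isLocallyRegular_of_fractionRing (h : IsVNRegular (FractionRing R[X])) :
    IsLocallyRegular R := by
  intro a
  obtain ⟨b, hb⟩ := h (algebraMap R _ a)
  obtain ⟨p, q, rfl⟩ := IsLocalization.exists_mk'_eq (nonZeroDivisors R[X]) b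
  have key : (q : R[X]) * C a = C a * p * C a := by
    apply IsFractionRing.injective R[X] (FractionRing R[X])
    have hs := IsLocalization.mk'_spec (FractionRing R[X]) p q
    rw [IsScalarTower.algebraMap_apply R R[X] (FractionRing R[X]), algebraMap_eq] at hb
    simp only [map_mul]
    rw [← hs]
    linear_combination (algebraMap R[X] (FractionRing R[X]) (q : R[X])) * hb
  refine ⟨_, mem_nonZeroDivisors_iff_isDense.1 q.2, fun j hj => ?_⟩
  have : j * a ∈ Ideal.span {a * a} := by
    have hle : Ideal.span ((q : R[X]).coeffs : Set R) ≤
        Submodule.comap (LinearMap.mulRight R a) (Ideal.span {a * a}) := by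
      rw [Ideal.span_le]
      intro x hx
      obtain ⟨n, -, rfl⟩ := mem_coeffs_iff.1 hx
      refine Ideal.mem_span_singleton'.2 ⟨p.coeff n, ?_⟩
      have := congrArg (fun p : R[X] => p.coeff n) key
      simp only [coeff_mul_C, coeff_C_mul] at this
      simp only [LinearMap.mulRight_apply, this]
      ring
    exact hle hj
  obtain ⟨r, hr⟩ := Ideal.mem_span_singleton'.1 this
  exact ⟨r, by rw [← hr]; ring⟩

theorem isLocallyRegular_of_finiteFractions (h : IsVNRegular (finiteFractions R)) :
    IsLocallyRegular R := by
  intro a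
  obtain ⟨⟨b, J, hJ, hb⟩, e⟩ := h (algebraMap R _ a)
  refine ⟨J, hJ, fun j hj => ?_⟩
  obtain ⟨r, hr⟩ := hb j hj
  refine ⟨r, algebraMap_injective ?_⟩
  have e' : algebraMap R (FractionRing R[X]) a = algebraMap R _ a * b * algebraMap R _ a :=
    congrArg Subtype.val e
  simp only [map_mul]
  rw [← hr, Algebra.smul_def]
  linear_combination (algebraMap R (FractionRing R[X]) j) * e'

theorem IsVNRegular.isReduced {A : Type u} [CommRing A] (h : IsVNRegular A) : IsReduced A := by
  refine (isReduced_iff_pow_one_lt 2 one_lt_two).2 fun x hx => ?_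
  obtain ⟨b, hb⟩ := h x
  rw [hb]
  linear_combination b * hx

theorem IsVNRegular.isField {A : Type u} [CommRing A] [IsLocalRing A] (h : IsVNRegular A) :
    IsField A := by
  refine ⟨exists_pair_ne A, mul_comm, fun {a} ha => ?_⟩
  obtain ⟨b, hb⟩ := h a
  refine ⟨b, ?_⟩
  -- Since `(1 - a * b) * a = 0`, a unit `1 - a * b` would force `a = 0`; a unit `a * b` is
  -- idempotent, hence `1`.
  rcases IsLocalRing.isUnit_or_isUnit_of_add_one (a := a * b) (b := 1 - a * b) (by ring) with h | h
  · exact h.mul_left_cancel (by linear_combination (-b) * hb)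
  · exact absurd (h.mul_left_cancel (by linear_combination hb)) ha

theorem prod_mem_annihilator_span {t : Finset R} {s : R → R} (h : ∀ x ∈ t, s x * x = 0) :
    ∏ x ∈ t, s x ∈ (Ideal.span (t : Set R)).annihilator := by
  classical
  refine (Submodule.mem_annihilator_span _ _).2 fun ⟨x, hx⟩ => ?_
  rw [← Finset.prod_erase_mul t s (Finset.mem_coe.1 hx), smul_eq_mul, mul_assoc,
    h x hx, mul_zero]

theorem hasDenseComplements_of_isVNRegular_localization
    (h : ∀ m : qMax R, IsVNRegular (Localization (m : Ideal R).primeCompl)) :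
    HasDenseComplements R := by
  intro K hK
  classical
  obtain ⟨J, hJ, hle⟩ := exists_mem_fgSemiregular_le (A := K ⊔ K.annihilator) fun m hm => by
    obtain ⟨hKm, hAm⟩ := sup_le_iff.1 hm
    obtain ⟨t, rfl⟩ := hK
    -- Elements of `𝔪` vanish in the field `R_𝔪`. The product of their killers annihilates `K` yet
    -- avoids `𝔪`, against `K.annihilator ≤ 𝔪`.
    have hz : ∀ x ∈ t, ∃ s ∈ (m : Ideal R).primeCompl, s * x = 0 := fun x hx => by
      have hu : algebraMap R (Localization (m : Ideal R).primeCompl) x = 0 := by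
        let _ := (h m).isField.toField
        by_contra hne
        exact (IsLocalization.AtPrime.isUnit_to_map_iff
          (Localization (m : Ideal R).primeCompl) (m : Ideal R) x).1 (IsUnit.mk0 _ hne)
          (hKm (Ideal.subset_span hx))
      obtain ⟨s, hs⟩ := (IsLocalization.map_eq_zero_iff (m : Ideal R).primeCompl _ x).1 hu
      exact ⟨s, s.2, hs⟩
    choose! s hs hsx using hz
    refine (Submonoid.prod_mem _ hs : ∏ x ∈ t, s x ∈ (m : Ideal R).primeCompl) 
      (hAm (prod_mem_annihilator_span hsx))
  exact exists_complement hK hJ hle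

/-- Complements give von Neumann regularity of `T(R[X])`: for a polynomial `f` there is `h` with
`f * h = 0` and `f + h` regular. -/
theorem HasDenseComplements.isVNRegular_fractionRing (h : HasDenseComplements R) :
    IsVNRegular (FractionRing R[X]) := by
  intro x
  obtain ⟨f, s, rfl⟩ := IsLocalization.exists_mk'_eq (nonZeroDivisors R[X]) x
  obtain ⟨g, hfg, hreg⟩ : ∃ g : R[X], f * g = 0 ∧ f + g ∈ nonZeroDivisors R[X] := by
    obtain ⟨L, ⟨t, rfl⟩, hKL, hd⟩ := h (Ideal.span (f.coeffs : Set R)) ⟨_, rfl⟩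
    have hc : ∀ n, f.coeff n ∈ Ideal.span (f.coeffs : Set R) := fun n => by
      by_cases hn : f.coeff n = 0
      · rw [hn]; exact zero_mem _
      · exact Ideal.subset_span (coeff_mem_coeffs hn)
    let e := t.equivFin
    -- The generators of `L` are placed in degrees above `f.natDegree`, so the nonzero coefficients
    -- of `f + g` are exactly those of `f` and `g` and generate `K ⊔ L`.
    let g : R[X] := ∑ i : Fin t.card, C ((e.symm i : R)) * X ^ (i + (f.natDegree + 1) : ℕ)
    have hg : ∀ n, g.coeff n ∈ Ideal.span (t : Set R) := fun n => by
      simp only [g, finsetSum_coeff, coeff_C_mul]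
      exact Ideal.sum_mem _ fun i _ =>
        Ideal.mul_mem_right _ _ (Ideal.subset_span (e.symm i).2)
    have hlow : ∀ n ≤ f.natDegree, g.coeff n = 0 := fun n hn => by
      simp only [g, finsetSum_coeff, coeff_C_mul, coeff_X_pow]
      exact Finset.sum_eq_zero fun i _ => by rw [if_neg (by omega), mul_zero]
    have hhigh : ∀ i : Fin t.card, g.coeff (i + (f.natDegree + 1)) = e.symm i := fun i => by
      simp only [g, finsetSum_coeff, coeff_C_mul, coeff_X_pow]
      rw [Finset.sum_eq_single i (fun j _ hj => by
        rw [if_neg (fun h => hj (Fin.ext (by omega))), mul_zero]) (by simp)]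
      simp
    refine ⟨g, ?_, ?_⟩
    · ext n
      rw [coeff_mul, coeff_zero]
      refine Finset.sum_eq_zero fun i _ => ?_
      have : f.coeff i.1 * g.coeff i.2 ∈ (⊥ : Ideal R) := hKL ▸ Ideal.mul_mem_mul (hc _) (hg _)
      simpa using this
    · rw [Polynomial.mem_nonZeroDivisors_iff]
      intro r hr
      have hr' : ∀ n, r * f.coeff n + r * g.coeff n = 0 := fun n => by
        simpa [mul_add] using congrArg (fun p : R[X] => p.coeff n) hr
      refine (mem_fgSemiregular_iff.1 hd).2 r fun a ha => ?_
      have hle : Ideal.span (f.coeffs : Set R) ⊔ Ideal.span (t : Set R) ≤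
          LinearMap.ker (LinearMap.mulRight R r) := by
        refine sup_le (Ideal.span_le.2 fun x hx => ?_) (Ideal.span_le.2 fun x hx => ?_)
        · obtain ⟨n, hn, rfl⟩ := mem_coeffs_iff.1 hx
          have := hr' n
          rw [hlow n (le_natDegree_of_mem_supp n hn), mul_zero, add_zero, mul_comm] at this
          exact this
        · have := hr' (e ⟨x, hx⟩ + (f.natDegree + 1))
          rw [hhigh, coeff_eq_zero_of_natDegree_lt (by omega), mul_zero, zero_add, mul_comm,
            Equiv.symm_apply_apply] at this
          exact this
      exact hle ha
  -- As `f * g = 0`, `f * f = f * (f + g)`, so `s / (f + g)` is a quasi-inverse of `f / s`.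
  refine ⟨IsLocalization.mk' _ (s : R[X]) (⟨f + g, hreg⟩ : nonZeroDivisors R[X]), ?_⟩
  rw [← IsLocalization.mk'_mul, ← IsLocalization.mk'_mul, IsLocalization.mk'_eq_iff_eq]
  congr 1
  simp only [Submonoid.coe_mul]
  linear_combination (s : R[X]) ^ 2 * hfg

theorem eq_zero_of_isDense_smul {I : Ideal R} (hI : IsDense I) {x : FractionRing R[X]}
    (hx : ∀ a ∈ I, a • x = 0) : x = 0 := by
  obtain ⟨f, s, rfl⟩ := IsLocalization.exists_mk'_eq (nonZeroDivisors R[X]) x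
  suffices f = 0 by rw [this, IsLocalization.mk'_zero]
  ext n
  refine hI _ fun a ha => ?_
  have h := hx a ha
  rw [Algebra.smul_def, IsScalarTower.algebraMap_apply R R[X] (FractionRing R[X]),
    IsLocalization.mul_mk'_eq_mk'_of_mul, IsLocalization.mk'_eq_zero_iff] at h
  obtain ⟨m, hm⟩ := h
  have h0 := (mem_nonZeroDivisors_iff.1 m.2).1 _ hm
  simpa using congrArg (fun p : R[X] => p.coeff n) h0

/-- Let `K = I x`, an ideal of `R`, with complement `L`. Since `I` is dense and `L K = 0`, `L` kills
`x`, hence also the reflexive quasi-inverse `y`; and `K² y ⊆ R` because `x * y * x = x`. So `(K +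
L)² y ⊆ R`, that is, `y ∈ Q₀(R)`. -/
theorem HasDenseComplements.isVNRegular_finiteFractions (h : HasDenseComplements R) :
    IsVNRegular (finiteFractions R) := by
  rintro ⟨x, I, hI, hx⟩
  obtain ⟨b, hb⟩ := h.isVNRegular_fractionRing x
  -- The replacement of `b` by `b * x * b` adds `y = y * x * y`, through which `L x = 0` passes to
  -- `L y = 0`.
  obtain ⟨y, hxy, hyx⟩ : ∃ y, x = x * y * x ∧ y = y * x * y :=
    ⟨b * x * b, by linear_combination (1 + b * x) * hb,
      by linear_combination (b ^ 2 + b ^ 3 * x) * hb⟩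
  let ψ : R →ₗ[R] FractionRing R[X] := Algebra.linearMap R _
  let K : Ideal R := Submodule.comap ψ
    (Submodule.map (LinearMap.toSpanSingleton R (FractionRing R[X]) x) I)
  have hKI : Submodule.map ψ K =
      Submodule.map (LinearMap.toSpanSingleton R (FractionRing R[X]) x) I := by
    refine Submodule.map_comap_eq_of_le ?_
    rintro _ ⟨a, ha, rfl⟩
    obtain ⟨r, hr⟩ := hx a ha
    exact ⟨r, hr.symm⟩
  have hK : K.FG := Submodule.fg_of_fg_map_injective ψ algebraMap_injective
    (by rw [hKI]; exact Submodule.FG.map _ hI.1)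
  have hKx : ∀ k ∈ K, ∃ i ∈ I, algebraMap R (FractionRing R[X]) k = i • x := fun k hk => by
    obtain ⟨i, hi, e⟩ := hk
    exact ⟨i, hi, e.symm⟩
  obtain ⟨L, -, hKL, hd⟩ := h K hK
  have hLx : ∀ l ∈ L, l • x = 0 := fun l hl =>
    eq_zero_of_isDense_smul (mem_fgSemiregular_iff.1 hI).2 fun a ha => by
      obtain ⟨k, hk⟩ := hx a ha
      have hkK : k ∈ K := ⟨a, ha, hk⟩
      have : k * l ∈ (⊥ : Ideal R) := hKL ▸ Ideal.mul_mem_mul hkK hl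
      rw [smul_comm, hk, Algebra.smul_def, ← map_mul, mul_comm, (Submodule.mem_bot R).1 this,
        map_zero]
  have hLy : ∀ l ∈ L, l • y = 0 := fun l hl => by
    rw [hyx, mul_comm y x, mul_assoc, ← smul_mul_assoc, hLx l hl, zero_mul]
  have hKy : ∀ k ∈ K, ∀ k' ∈ K, ∃ r : R, (k * k') • y = algebraMap R _ r := fun k hk k' hk' => by
    obtain ⟨i, -, hi⟩ := hKx k hk
    refine ⟨i * k', ?_⟩
    obtain ⟨i', -, hi'⟩ := hKx k' hk'
    simp only [Algebra.smul_def, map_mul] at hi hi' ⊢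
    rw [hi, hi']
    linear_combination (-algebraMap R (FractionRing R[X]) i *
      algebraMap R (FractionRing R[X]) i') * hxy
  refine ⟨⟨y, (K ⊔ L) * (K ⊔ L), mul_mem_fgSemiregular hd hd, fun a ha => ?_⟩, Subtype.ext hxy⟩
  have hle : (K ⊔ L) * (K ⊔ L) ≤
      Submodule.comap (LinearMap.toSpanSingleton R (FractionRing R[X]) y) (LinearMap.range ψ) := by
    refine Ideal.mul_le.2 fun p hp q hq => ?_
    obtain ⟨k, hk, l, hl, rfl⟩ := Submodule.mem_sup.1 hp
    obtain ⟨k', hk', l', hl', rfl⟩ := Submodule.mem_sup.1 hq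
    obtain ⟨r, hr⟩ := hKy k hk k' hk'
    refine ⟨r, ?_⟩
    have e : ((k + l) * (k' + l')) • y = (k * k') • y := by
      have e1 := hLy l hl
      have e2 := hLy l' hl'
      simp only [Algebra.smul_def, map_mul, map_add] at e1 e2 ⊢
      linear_combination (algebraMap R (FractionRing R[X]) k' +
        algebraMap R (FractionRing R[X]) l') * e1 + algebraMap R (FractionRing R[X]) k * e2
    rw [LinearMap.toSpanSingleton_apply, e, hr]
    rfl
  obtain ⟨r, hr⟩ := hle ha
  exact ⟨r, hr.symm⟩

/-! ### Reducedness and minimal primes -/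

theorem HasDenseComplements.isReduced (h : HasDenseComplements R) : IsReduced R := by
  refine (isReduced_iff_pow_one_lt 2 one_lt_two).2 fun x hx => ?_
  obtain ⟨J, hJ, hr⟩ := isLocallyRegular_of_mul_eq_sq h.exists_mul_eq_sq x
  refine (mem_fgSemiregular_iff.1 hJ).2 x fun j hj => ?_
  obtain ⟨r, e⟩ := hr j hj
  rw [e]
  linear_combination r * hx

theorem exists_mul_eq_zero_of_mem_minimalPrimes [IsReduced R] {p : Ideal R}
    (hp : p ∈ minimalPrimes R) {K : Ideal R} (hK : K.FG) (hKp : K ≤ p) :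
    ∃ s ∉ p, s ∈ K.annihilator := by
  classical
  have := hp.1.1
  obtain ⟨t, rfl⟩ := hK
  have hz : ∀ x ∈ t, ∃ s ∈ p.primeCompl, s * x = 0 := fun x hx => by
    obtain ⟨n, hn⟩ : IsNilpotent (algebraMap R (Localization.AtPrime p) x) := by
      -- By minimality every prime of `R_p` contracts to `p`, so the image of `x` is nilpotent;
      -- reducedness then turns `s * x ^ n = 0` into `s * x = 0`.
      refine nilpotent_iff_mem_prime.2 fun q hq => ?_
      obtain ⟨hq1, hq2⟩ := (IsLocalization.isPrime_iff_isPrime_disjoint p.primeCompl _ q).1 hq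
      refine hp.2 ⟨hq1, bot_le⟩ (fun y hy => ?_) (hKp (Ideal.subset_span hx))
      by_contra hyp
      exact Set.disjoint_left.1 hq2 hyp hy
    rw [← map_pow] at hn
    obtain ⟨s, hs⟩ := (IsLocalization.map_eq_zero_iff p.primeCompl _ _).1 hn
    refine ⟨s, s.2, IsReduced.eq_zero _ ⟨n + 1, ?_⟩⟩
    linear_combination (s : R) ^ n * x * hs
  choose! s hs hsx using hz
  exact ⟨∏ x ∈ t, s x, Submonoid.prod_mem _ hs, prod_mem_annihilator_span hsx⟩

/-- A finitely generated ideal inside a minimal prime has a nonzero annihilator, so is not dense.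
Conversely, if `x ∈ p` and `p` contains no member of `𝒬(R)`, the complement of `(x)` leaves `p`,
which puts `x` in every prime below `p`. -/
theorem mem_minimalPrimes_iff_forall_not_le (h : HasDenseComplements R) {p : Ideal R}
    (hp : p.IsPrime) : p ∈ minimalPrimes R ↔ ∀ J ∈ fgSemiregular R, ¬ J ≤ p := by
  have := h.isReduced
  constructor
  · intro hm J hJ hJp
    obtain ⟨s, hs, hsJ⟩ := exists_mul_eq_zero_of_mem_minimalPrimes hm hJ.1 hJp
    refine hs ((mem_fgSemiregular_iff.1 hJ).2 s (fun a ha => ?_) ▸ p.zero_mem)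
    rw [mul_comm]
    exact Submodule.mem_annihilator.1 hsJ a ha
  · intro hJ
    refine ⟨⟨hp, bot_le⟩, fun q hq hqp x hx => ?_⟩
    obtain ⟨L, -, hKL, hd⟩ := h (Ideal.span {x}) ⟨{x}, by simp⟩
    obtain ⟨l, hl, hlp⟩ : ∃ l ∈ L, l ∉ p := by
      by_contra! hLp
      exact hJ _ hd (sup_le ((Ideal.span_singleton_le_iff_mem _).2 hx) hLp)
    have hxl : x * l = 0 := (Submodule.mem_bot R).1
      (hKL ▸ Ideal.mul_mem_mul (Ideal.mem_span_singleton_self x) hl)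
    exact (hq.1.mem_or_mem (hxl ▸ q.zero_mem : x * l ∈ q)).resolve_right fun hlq => hlp (hqp hlq)

/-- Maximal `q`-ideals are minimal primes here, so the ideals defining an open cover have a sum
contained in none of them. The sum contains some `J ∈ 𝒬(R)`, already reached by finitely many
summands, and no minimal prime contains `J`. -/
theorem HasDenseComplements.isCompact_minimalPrimes (h : HasDenseComplements R) :
    IsCompact {p : PrimeSpectrum R | p.asIdeal ∈ minimalPrimes R} := by
  refine isCompact_of_finite_subcover fun {ι} U hU hcov => ?_
  choose s hs using fun i => (PrimeSpectrum.isOpen_iff (U i)).1 (hU i)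
  obtain ⟨J, hJ, hle⟩ := exists_mem_fgSemiregular_le (A := ⨆ i, Ideal.span (s i)) fun m hm => by
    have hmin : (⟨m, isPrime_qMax m⟩ : PrimeSpectrum R) ∈
        {p : PrimeSpectrum R | p.asIdeal ∈ minimalPrimes R} :=
      (mem_minimalPrimes_iff_forall_not_le h (isPrime_qMax m)).2 fun J hJ => not_le_qMax hJ m
    obtain ⟨i, hi⟩ := Set.mem_iUnion.1 (hcov hmin)
    have : (⟨m, isPrime_qMax m⟩ : PrimeSpectrum R) ∈ (U i)ᶜ := by
      rw [hs i, PrimeSpectrum.mem_zeroLocus, ← Ideal.span_le]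
      exact (le_iSup (fun i => Ideal.span (s i)) i).trans hm
    exact this hi
  obtain ⟨t, ht⟩ := CompleteLattice.IsCompactElement.exists_finset_of_le_iSup _
    ((Submodule.fg_iff_compact J).1 hJ.1) _ hle
  refine ⟨t, fun p hp => ?_⟩
  by_contra hpt
  refine (mem_minimalPrimes_iff_forall_not_le h p.2).1 hp J hJ
    (ht.trans (iSup₂_le fun i hi => Ideal.span_le.2 ?_))
  rw [← PrimeSpectrum.mem_zeroLocus, ← hs i]
  exact fun hpU => hpt (Set.mem_biUnion hi hpU)

theorem hasDenseComplements_of_isCompact_minimalPrimes [IsReduced R]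
    (h : IsCompact {p : PrimeSpectrum R | p.asIdeal ∈ minimalPrimes R}) :
    HasDenseComplements R := by
  intro K hK
  have hcov : {p : PrimeSpectrum R | p.asIdeal ∈ minimalPrimes R} ⊆
      ⋃ a : ↥(K ⊔ K.annihilator), (PrimeSpectrum.basicOpen (a : R) : Set (PrimeSpectrum R)) := by
    intro p hp
    rw [Set.mem_iUnion]
    by_cases hKp : K ≤ p.asIdeal
    · obtain ⟨s, hs, hsK⟩ := exists_mul_eq_zero_of_mem_minimalPrimes hp hK hKp
      exact ⟨⟨s, Ideal.mem_sup_right hsK⟩, hs⟩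
    · obtain ⟨k, hk, hkp⟩ := Set.not_subset.1 hKp
      exact ⟨⟨k, Ideal.mem_sup_left hk⟩, hkp⟩
  obtain ⟨t, ht⟩ := h.elim_finite_subcover _ (fun a => PrimeSpectrum.isOpen_basicOpen) hcov
  classical
  have hJ : Ideal.span ((t.image Subtype.val : Finset R) : Set R) ∈ fgSemiregular R := by
    refine mem_fgSemiregular_iff.2 ⟨⟨_, rfl⟩, fun r hr => ?_⟩
    have hnil : r ∈ nilradical R := by
      -- Each minimal prime misses a generator of the span, so contains any `r` killed by the span.
      rw [nilradical, ← Ideal.sInf_minimalPrimes, Submodule.mem_sInf]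
      intro p hp
      obtain ⟨a, hat, hap⟩ := Set.mem_iUnion₂.1 (ht (show (⟨p, hp.1.1⟩ : PrimeSpectrum R) ∈ _ from hp))
      refine (hp.1.1.mem_or_mem (?_ : (a : R) * r ∈ p)).resolve_left hap
      rw [hr a (Ideal.subset_span (Finset.mem_coe.2 (Finset.mem_image_of_mem _ hat)))]
      exact p.zero_mem
    simpa [nilradical_eq_zero] using hnil
  have hle : Ideal.span ((t.image Subtype.val : Finset R) : Set R) ≤ K ⊔ K.annihilator := by
    rw [Ideal.span_le]
    intro x hx
    obtain ⟨a, -, rfl⟩ := Finset.mem_image.1 (Finset.mem_coe.1 hx)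
    exact a.2
  exact exists_complement hK hJ hle

end Ideals

/-! ### Localized linear maps -/

section Localization

variable {R : Type u} [CommRing R] (S : Submonoid R)
variable {A B : Type u} [AddCommGroup A] [Module R A] [AddCommGroup B] [Module R B]

theorem localizedModule_map_apply_mk (f : A →ₗ[R] B) (x : A) (s : S) :
    LocalizedModule.map S f (LocalizedModule.mk x s) = LocalizedModule.mk (f x) s :=
  IsLocalizedModule.map_LocalizedModules S f x s

theorem localizedModule_map_injective_iff {f : A →ₗ[R] B} :
    Function.Injective (LocalizedModule.map S f) ↔ ∀ x, f x = 0 → ∃ s ∈ S, s • x = 0 := by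
  rw [injective_iff_map_eq_zero]
  constructor
  · intro h x hx
    have := h (LocalizedModule.mk x 1) (by
      rw [localizedModule_map_apply_mk, hx, LocalizedModule.zero_mk])
    obtain ⟨s, hs⟩ := LocalizedModule.mk_eq.1 (this.trans (LocalizedModule.zero_mk 1).symm)
    exact ⟨s, s.2, by simpa [Submonoid.smul_def] using hs⟩
  · intro h x hx
    induction x using LocalizedModule.induction_on with | _ x t
    rw [localizedModule_map_apply_mk, ← LocalizedModule.zero_mk t] at hx
    obtain ⟨s, hs⟩ := LocalizedModule.mk_eq.1 hx
    obtain ⟨s', hs', e⟩ := h (((s * t : S) : R) • x) (by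
      rw [map_smul]; simpa [mul_smul, Submonoid.smul_def] using hs)
    rw [← LocalizedModule.zero_mk t]
    exact LocalizedModule.mk_eq.2 ⟨⟨s', hs'⟩ * s,
      by simpa [mul_smul, Submonoid.smul_def] using e⟩

theorem localizedModule_map_surjective_iff {f : A →ₗ[R] B} :
    Function.Surjective (LocalizedModule.map S f) ↔ ∀ y, ∃ s ∈ S, ∃ x, f x = s • y := by
  constructor
  · intro h y
    obtain ⟨x, hx⟩ := h (LocalizedModule.mk y 1)
    induction x using LocalizedModule.induction_on with | _ x t
    rw [localizedModule_map_apply_mk] at hx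
    obtain ⟨s, hs⟩ := LocalizedModule.mk_eq.1 hx
    refine ⟨s * t, S.mul_mem s.2 t.2, (s : R) • x, ?_⟩
    simpa [mul_smul, Submonoid.smul_def] using hs
  · intro h y
    induction y using LocalizedModule.induction_on with | _ y t
    obtain ⟨s, hs, x, hx⟩ := h y
    refine ⟨LocalizedModule.mk x (⟨s, hs⟩ * t), ?_⟩
    rw [localizedModule_map_apply_mk, hx]
    exact LocalizedModule.mk_cancel_common_left ⟨s, hs⟩ t y

/-- A map whose localization has a left inverse stays injective after tensoring and localizing. -/
theorem exists_smul_eq_zero_of_lTensor {f : A →ₗ[R] B}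
    {g : LocalizedModule S B →ₗ[R] LocalizedModule S A}
    (hg : ∀ x, g (LocalizedModule.map S f x) = x) {M : Type u} [AddCommGroup M] [Module R M]
    {z : M ⊗[R] A} (hz : f.lTensor M z = 0) : ∃ s ∈ S, s • z = 0 := by
  -- The localization map of `A` factors through `f`, so its tensor product with `M` kills `z`; that
  -- tensor product is itself a localization map, with `S`-torsion kernel.
  have hc : LocalizedModule.mkLinearMap S A = g ∘ₗ LocalizedModule.mkLinearMap S B ∘ₗ f := by
    ext x
    exact ((congrArg g (localizedModule_map_apply_mk S f x 1)).symm.trans (hg _)).symm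
  have h0 : (LocalizedModule.mkLinearMap S A).rTensor M (TensorProduct.comm R M A z) = 0 := by
    rw [LinearMap.rTensor, TensorProduct.map_comm, ← LinearMap.lTensor, hc, LinearMap.lTensor_comp,
      LinearMap.lTensor_comp]
    simp [hz]
  have : IsLocalizedModule S ((LocalizedModule.mkLinearMap S A).rTensor M) :=
    IsLocalizedModule.rTensor (R := R) (A := R) (N := M) S (LocalizedModule.mkLinearMap S A)
  obtain ⟨s, hs⟩ := (IsLocalizedModule.eq_zero_iff S
    ((LocalizedModule.mkLinearMap S A).rTensor M)).1 h0
  refine ⟨s, s.2, (TensorProduct.comm R M A).injective ?_⟩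
  rw [map_smul, map_zero]
  exact hs

theorem exists_leftInverse_of_isField {K V W : Type u} [CommRing K] (hK : IsField K)
    [AddCommGroup V] [Module K V] [AddCommGroup W] [Module K W] {f : V →ₗ[K] W}
    (hf : Function.Injective f) : ∃ g : W →ₗ[K] V, ∀ x, g (f x) = x := by
  let _ : Field K := hK.toField
  obtain ⟨g, hg⟩ := f.exists_leftInverse_of_injective (LinearMap.ker_eq_bot.2 hf)
  exact ⟨g, LinearMap.congr_fun hg⟩

end Localization

/-! ### `τ_q`-monomorphisms, `τ_q`-flatness and dimension zero -/

section Modules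

variable {R : Type u} [CommRing R]
variable {A B C : Type u} [AddCommGroup A] [Module R A] [AddCommGroup B] [Module R B]
  [AddCommGroup C] [Module R C]

/-- The annihilator of a kernel element that dies at every `𝔪` lies in no `𝔪`, hence contains a
member of `𝒬(R)`. -/
theorem isTauQMono_iff {f : A →ₗ[R] B} :
    IsTauQMono f ↔ ∀ x, f x = 0 → ∃ I ∈ fgSemiregular R, ∀ a ∈ I, a • x = 0 := by
  simp only [IsTauQMono, localizedModule_map_injective_iff]
  constructor
  · intro h x hx
    obtain ⟨J, hJ, hle⟩ := exists_mem_fgSemiregular_le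
      (A := LinearMap.ker (LinearMap.toSpanSingleton R A x)) fun m hm => by
        obtain ⟨s, hs, e⟩ := h m x hx
        exact hs (hm e)
    exact ⟨J, hJ, fun a ha => hle ha⟩
  · intro h m x hx
    obtain ⟨I, hI, e⟩ := h x hx
    obtain ⟨s, hs, hsm⟩ := Set.not_subset.1 (not_le_qMax hI m)
    exact ⟨s, hsm, e s hs⟩

theorem IsTauQEpi.of_surjective {f : A →ₗ[R] B} (hf : Function.Surjective f) : IsTauQEpi f :=
  fun _ => (localizedModule_map_surjective_iff _).2 fun y =>
    ⟨1, Submonoid.one_mem _, by simpa using hf y⟩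

theorem IsTauQExact.of_exact {f : A →ₗ[R] B} {g : B →ₗ[R] C} (h : Function.Exact f g) :
    IsTauQExact f g :=
  fun m => LocalizedModule.map_exact (m : Ideal R).primeCompl f g h

theorem IsTauQMono.of_injective {f : A →ₗ[R] B} (hf : Function.Injective f) : IsTauQMono f :=
  isTauQMono_iff.2 fun x hx =>
    ⟨⊤, top_mem_fgSemiregular, fun a _ => by
      rw [(injective_iff_map_eq_zero f).1 hf x hx, smul_zero]⟩

theorem isTauQVNRegular_of_localization
    (h : ∀ m : qMax R, IsVNRegular (Localization (m : Ideal R).primeCompl)) :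
    IsTauQVNRegular R := by
  intro M _ _ A B _ _ _ _ f hf m
  refine (localizedModule_map_injective_iff _).2 fun z hz => ?_
  obtain ⟨g, hg⟩ := exists_leftInverse_of_isField (h m).isField (hf m)
  exact exists_smul_eq_zero_of_lTensor _ (g := g.restrictScalars R) hg hz

/-- `τ_q`-flatness is inherited by the target of a map that is a `τ_q`-mono- and
`τ_q`-epimorphism. -/
theorem IsTauQFlat.of_mono_epi {F M : Type u} [AddCommGroup F] [Module R F] [AddCommGroup M]
    [Module R M] (hF : IsTauQFlat R F) {ε : F →ₗ[R] M} (hm : IsTauQMono ε) (he : IsTauQEpi ε) :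
    IsTauQFlat R M := by
  intro A B _ _ _ _ f hf m
  set S := (m : Ideal R).primeCompl
  refine (localizedModule_map_injective_iff _).2 fun z hz => ?_
  let e := LinearEquiv.ofBijective (LocalizedModule.map S ε) ⟨hm m, he m⟩
  obtain ⟨s, hs, w, hw⟩ : ∃ s ∈ S, ∃ w, ε.rTensor A w = s • z := by
    clear hz
    induction z using TensorProduct.induction_on with
    | zero => exact ⟨1, S.one_mem, 0, by simp⟩
    | tmul x a =>
      obtain ⟨s, hs, y, hy⟩ := (localizedModule_map_surjective_iff _).1 (he m) x
      exact ⟨s, hs, y ⊗ₜ a, by rw [LinearMap.rTensor_tmul, hy, TensorProduct.smul_tmul']⟩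
    | add x y hx hy =>
      obtain ⟨s, hs, v, hv⟩ := hx
      obtain ⟨t, ht, w, hw⟩ := hy
      refine ⟨s * t, S.mul_mem hs ht, t • v + s • w, ?_⟩
      rw [map_add, map_smul, map_smul, hv, hw, smul_add, mul_smul, mul_smul, smul_comm t s x]
  -- By naturality `f` applied to the lift `w` dies in `M ⊗ B`. As `ε_𝔪` is invertible, some `t ∉ 𝔪`
  -- already kills it in `F ⊗ B`, where flatness of `F` applies.
  have h1 : ε.lTensor B (TensorProduct.comm R F B (f.lTensor F w)) = 0 := by
    rw [LinearMap.lTensor, TensorProduct.map_comm, ← LinearMap.rTensor, ← LinearMap.comp_apply,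
      LinearMap.rTensor_comp_lTensor, ← LinearMap.lTensor_comp_rTensor, LinearMap.comp_apply, hw,
      map_smul, hz, smul_zero, map_zero]
  obtain ⟨t, ht, h2⟩ := exists_smul_eq_zero_of_lTensor S
    (g := (e.symm : _ →ₗ[Localization S] _).restrictScalars R) e.symm_apply_apply h1
  rw [← map_smul, LinearEquiv.map_eq_zero_iff, ← map_smul] at h2
  obtain ⟨r, hr, h3⟩ := (localizedModule_map_injective_iff _).1 (hF A B f hf m) _ h2
  refine ⟨r * t * s, S.mul_mem (S.mul_mem hr ht) hs, ?_⟩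
  rw [mul_smul, ← hw, ← map_smul, mul_smul, h3, map_zero]

theorem isTauQFlat_of_subsingleton {M : Type u} [AddCommGroup M] [Module R M] [Subsingleton M] :
    IsTauQFlat R M := fun A _ _ _ _ _ f _ => by
  have h0 : ∀ z : M ⊗[R] A, z = 0 := fun z => by
    induction z using TensorProduct.induction_on with
    | zero => rfl
    | tmul x a => rw [Subsingleton.elim x 0, TensorProduct.zero_tmul]
    | add x y hx hy => rw [hx, hy, add_zero]
  exact IsTauQMono.of_injective fun x y _ => (h0 x).trans (h0 y).symm

theorem mk_one_tmul_smul_eq_zero {K : Ideal R} {x : R} (hx : x ∈ K) (a : A) :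
    (Submodule.Quotient.mk (1 : R) : R ⧸ K) ⊗ₜ[R] (x • a) = 0 := by
  rw [← TensorProduct.smul_tmul, ← Submodule.Quotient.mk_smul,
    (Submodule.Quotient.mk_eq_zero K).2 (by simpa using hx), TensorProduct.zero_tmul]

theorem tauQFlatDim_eq_zero_iff {M : Type u} [AddCommGroup M] [Module R M] :
    tauQFlatDim R M = 0 ↔ IsTauQFlat R M := by
  rw [tauQFlatDim, ENat.sInf_eq_zero]
  constructor
  · rintro ⟨n, hn, F, d, ε, hF, hs, he, hx, -⟩
    obtain rfl : n = 0 := by exact_mod_cast hn.symm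
    refine (hF 0).of_mono_epi (fun m => ?_) he
    -- With `F 1 = 0`, exactness at `F 0` makes `ε` a `τ_q`-monomorphism.
    have := hs 1 one_pos
    have hd : d 0 = 0 := LinearMap.ext fun x => by rw [Subsingleton.elim x 0, map_zero, map_zero]
    refine (injective_iff_map_eq_zero _).2 fun x hx0 => ?_
    obtain ⟨y, rfl⟩ := (hx m x).1 hx0
    rw [hd, map_zero, LinearMap.zero_apply]
  · intro h
    refine ⟨0, rfl, fun i => Nat.casesOn i (ModuleCat.of R M) fun _ => ModuleCat.of R PUnit,
      fun i => 0, LinearMap.id, ?_, ?_, ?_, ?_, ?_⟩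
    · rintro (_ | i)
      · exact h
      · exact isTauQFlat_of_subsingleton (M := PUnit)
    · rintro (_ | i) hi
      · exact absurd hi (lt_irrefl 0)
      · exact inferInstanceAs (Subsingleton PUnit)
    · exact IsTauQEpi.of_surjective Function.surjective_id
    · refine IsTauQExact.of_exact fun x => ?_
      exact ⟨fun hx => ⟨0, hx.symm⟩, fun ⟨_, hx⟩ => hx.symm⟩
    · refine fun i => IsTauQExact.of_exact fun x => ?_
      exact ⟨fun _ => ⟨0, Subsingleton.elim (α := PUnit) _ _⟩, fun _ => rfl⟩

theorem tauQWeakGlobalDim_eq_zero_iff : tauQWeakGlobalDim R = 0 ↔ IsTauQVNRegular R := by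
  rw [tauQWeakGlobalDim, ← bot_eq_zero, iSup_eq_bot]
  simp only [bot_eq_zero, tauQFlatDim_eq_zero_iff]
  exact ⟨fun h M _ _ => h (ModuleCat.of R M), fun h M => h M⟩

theorem isTauQFG_of_fg {I : Ideal R} (hI : I.FG) : IsTauQFG R I := by
  have : Module.Finite R I := Module.Finite.iff_fg.2 hI
  obtain ⟨n, f, hf⟩ := Module.Finite.exists_fin' R I
  exact ⟨n, f, IsTauQEpi.of_surjective hf⟩

theorem exists_mul_eq_sq_of_forall_mem {K : Ideal R} (hK : K.FG)
    (h : ∀ x ∈ K, ∃ I ∈ fgSemiregular R, ∀ a ∈ I, a * x ∈ K ^ 2) :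
    ∃ I ∈ fgSemiregular R, I * K = K ^ 2 := by
  obtain ⟨I, hI, hIK⟩ : ∃ I ∈ fgSemiregular R, I * K ≤ K ^ 2 := by
    obtain ⟨t, ht⟩ := hK
    choose! I hI hIx using fun x hx => h x (ht ▸ Ideal.subset_span hx)
    refine ⟨∏ x ∈ t, I x, ?_, ?_⟩
    · exact Finset.prod_induction I (· ∈ fgSemiregular R)
        (fun _ _ => mul_mem_fgSemiregular) (Ideal.one_eq_top (R := R) ▸ top_mem_fgSemiregular) hI
    · refine Ideal.mul_le.2 fun a ha k hk => ?_
      have hle : K ≤ Submodule.comap (LinearMap.mulLeft R a) (K ^ 2) := by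
        rw [← ht]
        refine Ideal.span_le.2 fun x hx => ?_
        rw [SetLike.mem_coe, Submodule.mem_comap, ht]
        exact hIx x hx a (Ideal.prod_le_inf.trans (Finset.inf_le (Finset.mem_coe.1 hx)) ha)
      exact hle hk
  -- Enlarging `I` by `K` turns `I * K ≤ K ^ 2` into an equality.
  refine ⟨I ⊔ K, mem_fgSemiregular_of_le hI (Submodule.FG.sup hI.1 hK) le_sup_left, ?_⟩
  rw [Ideal.sup_mul, ← sq, sup_eq_right]
  exact hIK

theorem exists_mul_eq_sq_of_isTauQFlat {K : Ideal R} (hK : K.FG) (h : IsTauQFlat R (R ⧸ K)) :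
    ∃ I ∈ fgSemiregular R, I * K = K ^ 2 := by
  refine exists_mul_eq_sq_of_forall_mem hK fun x hx => ?_
  have h1 := h K R K.subtype (IsTauQMono.of_injective K.subtype_injective)
  obtain ⟨I, hI, h2⟩ := isTauQMono_iff.1 h1 ((1 : R ⧸ K) ⊗ₜ ⟨x, hx⟩) (by
    simpa using mk_one_tmul_smul_eq_zero hx (1 : R))
  -- The pairing `(r, y) ↦ r * y` modulo `K ^ 2` sends the torsion element `1 ⊗ x` to the class of
  -- `x`.
  let φ : (R ⧸ K) →ₗ[R] K →ₗ[R] R ⧸ (K ^ 2) :=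
    Submodule.liftQ K (LinearMap.toSpanSingleton R _ ((K ^ 2).mkQ ∘ₗ K.subtype)) fun k hk => by
      rw [LinearMap.mem_ker, LinearMap.toSpanSingleton_apply]
      ext y
      refine (Submodule.Quotient.mk_eq_zero _).2 ?_
      rw [sq]
      exact Ideal.mul_mem_mul hk y.2
  refine ⟨I, hI, fun a ha => (Submodule.Quotient.mk_eq_zero (K ^ 2)).1 ?_⟩
  have h3 := congrArg (TensorProduct.lift φ) (h2 a ha)
  rw [map_smul, map_zero, TensorProduct.lift.tmul] at h3
  have h4 : φ 1 ⟨x, hx⟩ = Submodule.Quotient.mk x := by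
    change (1 : R) • (Submodule.Quotient.mk x : R ⧸ (K ^ 2)) = _
    rw [one_smul]
  rw [h4] at h3
  exact h3

end Modules

/-! ### Torsion in Tor -/

section Tor

open CategoryTheory

variable {R : Type u} [CommRing R]

theorem IsQTorsion.of_linearEquiv {M N : Type u} [AddCommGroup M] [Module R M] [AddCommGroup N]
    [Module R N] (h : IsQTorsion R M) (e : M ≃ₗ[R] N) : IsQTorsion R N := fun x => by
  obtain ⟨I, hI, h⟩ := h (e.symm x)
  exact ⟨I, hI, fun a ha => e.symm.injective (by rw [map_smul, h a ha, map_zero])⟩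

theorem isQTorsion_congr {M N : Type u} [AddCommGroup M] [Module R M] [AddCommGroup N]
    [Module R N] (e : M ≃ₗ[R] N) : IsQTorsion R M ↔ IsQTorsion R N :=
  ⟨fun h => h.of_linearEquiv e, fun h => h.of_linearEquiv e.symm⟩

theorem isQTorsion_homology_iff (S : ShortComplex (ModuleCat.{u} R)) :
    IsQTorsion R S.homology ↔ ∀ z, S.g.hom z = 0 →
      ∃ I ∈ fgSemiregular R, ∀ a ∈ I, ∃ y, S.f.hom y = a • z := by
  rw [isQTorsion_congr S.moduleCatHomologyIso.toLinearEquiv]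
  have key : ∀ (z : LinearMap.ker S.g.hom) (a : R),
      a • (Submodule.Quotient.mk z : LinearMap.ker S.g.hom ⧸ LinearMap.range S.moduleCatToCycles)
        = 0 ↔ ∃ y, S.f.hom y = a • (z : S.X₂) := fun z a => by
    rw [← Submodule.Quotient.mk_smul, Submodule.Quotient.mk_eq_zero]
    exact exists_congr fun y => Subtype.ext_iff
  constructor
  · intro h z hz
    obtain ⟨I, hI, h⟩ := h (Submodule.Quotient.mk ⟨z, hz⟩)
    exact ⟨I, hI, fun a ha => (key _ a).1 (h a ha)⟩
  · intro h x
    obtain ⟨z, rfl⟩ := Submodule.Quotient.mk_surjective _ x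
    obtain ⟨I, hI, h⟩ := h z z.2
    exact ⟨I, hI, fun a ha => (key _ a).2 (h a ha)⟩

theorem isQTorsion_torModule_succ_iff {M N : ModuleCat.{u} R} (P : ProjectiveResolution N)
    (k : ℕ) :
    IsQTorsion R (TorModule R (k + 1) M N) ↔ ∀ z : M ⊗[R] P.complex.X (k + 1),
      (P.complex.d (k + 1) k).hom.lTensor M z = 0 →
      ∃ I ∈ fgSemiregular R, ∀ a ∈ I, ∃ y,
        (P.complex.d (k + 2) (k + 1)).hom.lTensor M y = a • z := by
  refine (isQTorsion_congr ((P.isoLeftDerivedObj ((MonoidalCategory.tensoringLeft _).obj M) (k + 1)) ≪≫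
    HomologicalComplex.homologyIsoSc' _ (k + 2) (k + 1) k (by simp) (by simp)).toLinearEquiv).trans
    (isQTorsion_homology_iff _)

theorem IsTauQVNRegular.isQTorsion_torModule (h : IsTauQVNRegular R) (M N : ModuleCat.{u} R)
    (k : ℕ) : IsQTorsion R (TorModule R (k + 1) M N) := by
  let P := projectiveResolution N
  rw [isQTorsion_torModule_succ_iff P]
  intro z hz
  set d₂ := (P.complex.d (k + 2) (k + 1)).hom
  set d₁ := (P.complex.d (k + 1) k).hom
  have hex : Function.Exact d₂ d₁ :=
    (ShortComplex.ShortExact.moduleCat_exact_iff_function_exact _).1 (P.exact_succ k)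
  -- The cokernel of `d₂` embeds in the next term, and `M ⊗ -` keeps this embedding `τ_q`-injective;
  -- right exactness turns a torsion class in `M ⊗ coker d₂` into a boundary.
  let j : (P.complex.X (k + 1) ⧸ LinearMap.range d₂) →ₗ[R] P.complex.X k :=
    (LinearMap.range d₂).liftQ d₁ hex.linearMap_ker_eq.ge
  have hj : Function.Injective j := by
    rw [← LinearMap.ker_eq_bot, Submodule.ker_liftQ_eq_bot]
    exact hex.linearMap_ker_eq.le
  have hjd : j ∘ₗ (LinearMap.range d₂).mkQ = d₁ := Submodule.liftQ_mkQ _ _ _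
  obtain ⟨I, hI, h0⟩ := isTauQMono_iff.1 (h M _ _ j (IsTauQMono.of_injective hj))
    ((LinearMap.range d₂).mkQ.lTensor M z)
    (by rw [← LinearMap.comp_apply, ← LinearMap.lTensor_comp, hjd, hz])
  refine ⟨I, hI, fun a ha => ?_⟩
  have hex' : Function.Exact d₂ (LinearMap.range d₂).mkQ := LinearMap.exact_map_mkQ_range d₂
  exact (lTensor_exact M hex' (Submodule.mkQ_surjective _) _).1 (by rw [map_smul, h0 a ha])

/-- A lift `φ` of the augmentation to `R` sends boundaries of degree zero into `K`, hence defines a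
map from `Tor₁(R/K, R/K)` to `K/K²`; the class of each `x ∈ K` is attained. -/
theorem exists_mul_eq_sq_of_isQTorsion_tor {K : Ideal R} (hK : K.FG)
    (h : IsQTorsion R (TorModule R 1 (ModuleCat.of R (R ⧸ K)) (ModuleCat.of R (R ⧸ K)))) :
    ∃ I ∈ fgSemiregular R, I * K = K ^ 2 := by
  let P := projectiveResolution (ModuleCat.of R (R ⧸ K))
  rw [isQTorsion_torModule_succ_iff P 0] at h
  refine exists_mul_eq_sq_of_forall_mem hK fun x hx => ?_
  set d₂ := (P.complex.d 2 1).hom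
  set d₁ := (P.complex.d 1 0).hom
  let ε : P.complex.X 0 →ₗ[R] (R ⧸ K) := (P.π.f 0).hom
  have hε : Function.Surjective ε := (ModuleCat.epi_iff_surjective (P.π.f 0)).1 inferInstance
  have hex : Function.Exact d₁ ε :=
    (ShortComplex.ShortExact.moduleCat_exact_iff_function_exact _).1 P.exact₀
  have hdd : ∀ y, d₁ (d₂ y) = 0 := fun y =>
    LinearMap.congr_fun (congrArg ModuleCat.Hom.hom (P.complex.d_comp_d 2 1 0)) y
  have : Module.Projective R (P.complex.X 0) :=
    (IsProjective.iff_projective (P.complex.X 0)).2 (P.projective 0)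
  obtain ⟨φ, hφ⟩ := Module.projective_lifting_property K.mkQ ε K.mkQ_surjective
  have hφK : ∀ w, φ (d₁ w) ∈ K := fun w => by
    rw [← Submodule.Quotient.mk_eq_zero K, ← Submodule.mkQ_apply, ← LinearMap.comp_apply, hφ]
    exact hex.apply_apply_eq_zero w
  -- `e` lifts `1` and `y` bounds `x • e`. The cycle `1 ⊗ y` goes to `x * φ e`, congruent to `x`
  -- modulo `K ^ 2` because `φ e - 1 ∈ K`.
  obtain ⟨e, he⟩ := hε (Submodule.Quotient.mk 1)
  obtain ⟨y, hy⟩ := (hex (x • e)).1 (by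
    rw [map_smul, he, ← Submodule.Quotient.mk_smul, Submodule.Quotient.mk_eq_zero]
    simpa using hx)
  obtain ⟨I, hI, hI'⟩ := h ((Submodule.Quotient.mk 1 : R ⧸ K) ⊗ₜ y) (by
    rw [LinearMap.lTensor_tmul]
    exact (congrArg _ hy).trans (mk_one_tmul_smul_eq_zero hx e))
  refine ⟨I, hI, fun a ha => ?_⟩
  obtain ⟨w, hw⟩ := hI' a ha
  let ψ : (R ⧸ K) →ₗ[R] P.complex.X 1 →ₗ[R] R ⧸ (K ^ 2) :=
    Submodule.liftQ K (LinearMap.toSpanSingleton R _ ((K ^ 2).mkQ ∘ₗ φ ∘ₗ d₁)) fun k hk => by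
      rw [LinearMap.mem_ker, LinearMap.toSpanSingleton_apply]
      ext y
      refine (Submodule.Quotient.mk_eq_zero _).2 ?_
      rw [sq]
      exact Ideal.mul_mem_mul hk (hφK y)
  have hψ : ∀ w, TensorProduct.lift ψ (d₂.lTensor _ w) = 0 := fun w => by
    induction w using TensorProduct.induction_on with
    | zero => simp
    | tmul r v =>
      obtain ⟨r, rfl⟩ := Submodule.Quotient.mk_surjective _ r
      rw [LinearMap.lTensor_tmul, TensorProduct.lift.tmul]
      change r • (Submodule.Quotient.mk (φ (d₁ (d₂ v))) : R ⧸ (K ^ 2)) = 0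
      rw [hdd, map_zero, Submodule.Quotient.mk_zero, smul_zero]
    | add a b ha hb => rw [map_add, map_add, ha, hb, add_zero]
  have h1 : (Submodule.Quotient.mk (a * (x * φ e)) : R ⧸ (K ^ 2)) = 0 := by
    rw [← hψ w]
    refine Eq.trans ?_ (congrArg (TensorProduct.lift ψ) hw).symm
    rw [map_smul, TensorProduct.lift.tmul]
    change _ = a • (1 : R) • (Submodule.Quotient.mk (φ (d₁ y)) : R ⧸ (K ^ 2))
    rw [hy, map_smul, one_smul]
    rfl
  have h2 : φ e - 1 ∈ K := by
    rw [← Submodule.Quotient.eq K, ← he, ← hφ]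
    rfl
  have h3 : x * (φ e - 1) ∈ K ^ 2 := sq K ▸ Ideal.mul_mem_mul hx h2
  have h4 := sub_mem ((Submodule.Quotient.mk_eq_zero _).1 h1) ((K ^ 2).mul_mem_left a h3)
  convert h4 using 1
  ring

end Tor

end QOp

theorem mainTheorem4 (R : Type u) [CommRing R] :
    List.TFAE [
      QOp.tauQWeakGlobalDim R = 0,
      QOp.IsTauQVNRegular R,
      ∀ (M N : ModuleCat.{u} R) (k : ℕ), 0 < k → QOp.IsQTorsion R (QOp.TorModule R k M N),
      ∀ M N : ModuleCat.{u} R, QOp.IsQTorsion R (QOp.TorModule R 1 M N),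
      ∀ I : Ideal R, QOp.IsTauQFlat R (R ⧸ I),
      ∀ I : Ideal R, QOp.IsTauQFG R I → QOp.IsTauQFlat R (R ⧸ I),
      ∀ I : Ideal R, I.FG → QOp.IsTauQFlat R (R ⧸ I),
      ∀ K : Ideal R, K.FG → ∃ I ∈ QOp.fgSemiregular R, I * K = K ^ 2,
      ∀ m : QOp.qMax R, QOp.IsVNRegular (Localization (m : Ideal R).primeCompl),
      QOp.IsVNRegular (FractionRing (Polynomial R)),
      IsReduced R ∧ IsCompact {p : PrimeSpectrum R | p.asIdeal ∈ minimalPrimes R},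
      QOp.IsVNRegular (QOp.finiteFractions R)] := by
  tfae_have 1 ↔ 2 := QOp.tauQWeakGlobalDim_eq_zero_iff
  tfae_have 2 → 3 := fun h M N k hk => by
    obtain ⟨k, rfl⟩ := Nat.exists_eq_succ_of_ne_zero hk.ne'
    exact h.isQTorsion_torModule M N k
  tfae_have 3 → 4 := fun h M N => h M N 1 one_pos
  tfae_have 4 → 8 := fun h K hK => QOp.exists_mul_eq_sq_of_isQTorsion_tor hK (h _ _)
  tfae_have 2 → 5 := fun h I => h (R ⧸ I)
  tfae_have 5 → 6 := fun h I _ => h I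
  tfae_have 6 → 7 := fun h I hI => h I (QOp.isTauQFG_of_fg hI)
  tfae_have 7 → 8 := fun h K hK => QOp.exists_mul_eq_sq_of_isTauQFlat hK (h K hK)
  tfae_have 8 → 9 := fun h => (QOp.isLocallyRegular_of_mul_eq_sq h).isVNRegular_localization
  tfae_have 9 → 2 := QOp.isTauQVNRegular_of_localization
  tfae_have 9 → 10 := fun h =>
    (QOp.hasDenseComplements_of_isVNRegular_localization h).isVNRegular_fractionRing
  tfae_have 10 → 9 := fun h => (QOp.isLocallyRegular_of_fractionRing h).isVNRegular_localization
  tfae_have 9 → 11 := fun h =>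
    have hc := QOp.hasDenseComplements_of_isVNRegular_localization h
    ⟨hc.isReduced, hc.isCompact_minimalPrimes⟩
  tfae_have 11 → 8 := fun ⟨_, h⟩ =>
    (QOp.hasDenseComplements_of_isCompact_minimalPrimes h).exists_mul_eq_sq
  tfae_have 9 → 12 := fun h =>
    (QOp.hasDenseComplements_of_isVNRegular_localization h).isVNRegular_finiteFractions
  tfae_have 12 → 9 := fun h => (QOp.isLocallyRegular_of_finiteFractions h).isVNRegular_localization
  tfae_finish
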